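/- Let $X$ be a finite set of propositional variables containing four pairwise distinct variables $a,x,y,z$. A trace over $X$ is an infinite sequence $\tau=\tau[0]\tau[1]\dots$ of valuations $X\to\{0,1\}$. For a set $T$ of traces over $X$ let $T[\ldots a]$ be the set of finite prefixes $\tau[0]\dots\tau[k-1]$, and $T[a\ldots]$ the set of suffixes $\tau[k]\tau[k+1]\dots$, where $\tau$ ranges over the traces in $T$ in which $a$ holds at least once and $k$ is the first position of $\tau$ at which $a$ holds. For a set $S$ of finite or infinite traces and variables $u,v$, say that $S\models \mathrm{ind}_{\mathrm{point}}(u,v)$ if for all $i\in\mathbb N$ and all $\pi,\pi'\in S$ there is $\rho\in S$ such that, if position $i$ exists in both $\pi$ and $\pi'$, then it exists in $\rho$, $\rho[i](u)=\pi[i](u)$ and $\rho[i](v)=\pi'[i](v)$; and that $S\models \mathrm{ind}_{\mathrm{seg}}(u,v)$ if for all $\pi,\pi'\in S$ there is $\rho\in S$ such that the same holds for all $i\in\mathbb N$ simultaneously. For $\mathrm{ind}\in\{\mathrm{ind}_{\mathrm{point}},\mathrm{ind}_{\mathrm{seg}}\}$ put $$\mathbf T^{\mathrm{async}}_{\mathrm{ind}}=\{T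 \mid T[\ldots a]\models \mathrm{ind}(x,y)\text{ and }T[a\ldots]\models \mathrm{ind}(x,z)\},$$ $$\mathbf T^{\mathrm{hidden}}_{\mathrm{ind}}=\{T|_a \mid T\in\mathbf T^{\mathrm{async}}_{\mathrm{ind}}\text{ and } a \text{ holds at least once in every trace of } T\},$$ where $T|_a$ is the set of traces over $X\setminus\{a\}$ obtained from the traces of $T$ by removing the values of $a$. HyperLTL formulas are $\psi ::= \exists\pi\,\psi\mid\forall\pi\,\psi\mid\varphi$ with $\varphi ::= b_\pi\mid\neg\varphi\mid\varphi\vee\varphi\mid\mathbf X\varphi\mid\varphi\,\mathbf U\,\varphi$, where $b$ is a propositional variable and $\pi$ a trace variable, with the usual semantics over a set $T$ of traces (the quantifiers range over $T$). A sentence is a formula without free trace variables, and $[\![\varphi]\!]$ is the set of all sets of traces, over the alphabet of $\varphi$, that satisfy the sentence $\varphi$ at position $0$. Then for every HyperLTL sentence $\varphi$ over $X$, $$[\![\varphi]\!]\neq\mathbf T^{\mathrm{async}}_{\mathrm{point}}\quad\text{and}\quad[\![\varphi]\!]\neq\mathbf T^{\mathrm{async}}_{\mathrm{seg}},$$ and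 for every HyperLTL sentence $\varphi$ over $X\setminus\{a\}$, $$[\![\varphi]\!]\neq\mathbf T^{\mathrm{hidden}}_{\mathrm{point}}\quad\text{and}\quad[\![\varphi]\!]\neq\mathbf T^{\mathrm{hidden}}_{\mathrm{seg}}.$$ -/

import Mathlib

namespace TwoState

/-- A valuation of the propositional variables `X`. -/
abbrev Valuation (X : Type*) : Type _ := X → Bool

/-- An infinite trace over `X`. -/
abbrev Trace (X : Type*) : Type _ := ℕ → Valuation X

/-- A finite or infinite trace over `X`; the empty trace is allowed. -/
inductive GTrace (X : Type*) where
  | finite (l : List (Valuation X))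
  | infinite (τ : Trace X)

/-- The letter `τ[i]`, or `none` when `i` is not below the length of `τ`. -/
def GTrace.letter {X : Type*} : GTrace X → ℕ → Option (Valuation X)
  | .finite l, i => l[i]?
  | .infinite τ, i => some (τ i)

/-- The predicate `def(τ, i)`: the position `i` is below the length of `τ`. -/
def GTrace.Defined {X : Type*} (τ : GTrace X) (i : ℕ) : Prop :=
  ∃ v, τ.letter i = some v

/-- The predicate `b(τ, i)`: the letter `τ[i]` exists and makes `b` true. -/
def GTrace.Holds {X : Type*} (b : X) (τ : GTrace X) (i : ℕ) : Prop :=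
  ∃ v, τ.letter i = some v ∧ v b = true

/-! ### Independence -/

/-- `y` is independent from `x` in `T` under point semantics. -/
def PointIndep {X : Type*} (x y : X) (T : Set (GTrace X)) : Prop :=
  ∀ i : ℕ, ∀ π ∈ T, ∀ π' ∈ T, ∃ ρ ∈ T,
    (π.Defined i ∧ π'.Defined i) →
      (ρ.Defined i ∧ (π.Holds x i ↔ ρ.Holds x i) ∧ (π'.Holds y i ↔ ρ.Holds y i))

/-- `y` is independent from `x` in `T` under segment semantics. -/
def SegmentIndep {X : Type*} (x y : X) (T : Set (GTrace X)) : Prop :=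
  ∀ π ∈ T, ∀ π' ∈ T, ∃ ρ ∈ T, ∀ i : ℕ,
    (π.Defined i ∧ π'.Defined i) →
      (ρ.Defined i ∧ (π.Holds x i ↔ ρ.Holds x i) ∧ (π'.Holds y i ↔ ρ.Holds y i))

/-! ### Slicing -/

/-- `min(τ, a, k)`: the variable `a` holds at `k` for the first time. -/
def IsFirst {X : Type*} (τ : Trace X) (a : X) (k : ℕ) : Prop :=
  τ k a = true ∧ ∀ j, τ j a = true → k ≤ j

/-- The finite prefix `τ[0] … τ[k-1]`. -/
def prefixOf {X : Type*} (τ : Trace X) (k : ℕ) : GTrace X :=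
  .finite (List.ofFn fun j : Fin k => τ j)

/-- The suffix `τ[k] τ[k+1] …`. -/
def suffixOf {X : Type*} (τ : Trace X) (k : ℕ) : GTrace X :=
  .infinite fun i => τ (k + i)

/-- `T[… a]`: the prefixes strictly before the first `a`. -/
def sliceBefore {X : Type*} (a : X) (T : Set (Trace X)) : Set (GTrace X) :=
  {σ | ∃ τ ∈ T, ∃ k, IsFirst τ a k ∧ σ = prefixOf τ k}

/-- `T[a …]`: the suffixes from the first `a` on. -/
def sliceFrom {X : Type*} (a : X) (T : Set (Trace X)) : Set (GTrace X) :=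
  {σ | ∃ τ ∈ T, ∃ k, IsFirst τ a k ∧ σ = suffixOf τ k}

/-! ### Two-state independence -/

/-- Two-state independence with an asynchronous action `a`, for the interpretation `ind` of
independence. -/
def asyncIndep {X : Type*} (ind : X → X → Set (GTrace X) → Prop) (a x y z : X) :
    Set (Set (Trace X)) :=
  {T | ind x y (sliceBefore a T) ∧ ind x z (sliceFrom a T)}

/-- The trace `τ` with the values of `a` removed. -/
def hideTrace {X : Type*} (a : X) (τ : Trace X) : Trace {b : X // b ≠ a} :=
  fun i b => τ i b.1

/-- Two-state independence with a hidden action: the sets of traces without the variable `a` that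
arise by removing `a` from a set of traces which satisfies two-state independence with the action
`a`, and in each trace of which the action does take place. -/
def hiddenIndep {X : Type*} (ind : X → X → Set (GTrace X) → Prop) (a x y z : X) :
    Set (Set (Trace {b : X // b ≠ a})) :=
  {S | ∃ T ∈ asyncIndep ind a x y z, (∀ τ ∈ T, ∃ i, τ i a = true) ∧ S = hideTrace a '' T}

/-! ### HyperLTL -/

/-- Quantifier-free HyperLTL formulas, with propositional variables in `X` and trace variables
in `V`. -/
inductive Body (X V : Type*) where
  | atom (b : X) (π : V)
  | neg (φ : Body X V)
  | or (φ ψ : Body X V)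
  | next (φ : Body X V)
  | until (φ ψ : Body X V)

/-- HyperLTL formulas: trace quantifiers followed by a quantifier-free formula. -/
inductive HyperLTL (X V : Type*) where
  | ex (π : V) (φ : HyperLTL X V)
  | all (π : V) (φ : HyperLTL X V)
  | body (φ : Body X V)

/-- The trace variables that occur in a quantifier-free formula. -/
def Body.vars {X V : Type*} : Body X V → Set V
  | .atom _ π => {π}
  | .neg φ => φ.vars
  | .or φ ψ => φ.vars ∪ ψ.vars
  | .next φ => φ.vars
  | .until φ ψ => φ.vars ∪ ψ.vars

/-- The free trace variables of a formula. -/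
def HyperLTL.free {X V : Type*} : HyperLTL X V → Set V
  | .ex π φ => φ.free \ {π}
  | .all π φ => φ.free \ {π}
  | .body φ => φ.vars

/-- A sentence is a formula without free trace variables. -/
def HyperLTL.IsSentence {X V : Type*} (φ : HyperLTL X V) : Prop :=
  φ.free = ∅

/-- Partial assignments of traces in `T` to trace variables. -/
abbrev Assignment {X : Type*} (V : Type*) (T : Set (Trace X)) : Type _ := V → Option T

/-- Satisfaction of a quantifier-free formula at position `i`. -/
def Body.Sat {X V : Type*} {T : Set (Trace X)} (A : Assignment V T) : Body X V → ℕ → Prop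
  | .atom b π, i => ∃ τ : T, A π = some τ ∧ τ.1 i b = true
  | .neg φ, i => ¬ φ.Sat A i
  | .or φ ψ, i => φ.Sat A i ∨ ψ.Sat A i
  | .next φ, i => φ.Sat A (i + 1)
  | .until φ ψ, i => ∃ j, i ≤ j ∧ ψ.Sat A j ∧ ∀ j', i ≤ j' → j' < j → φ.Sat A j'

/-- Satisfaction of a HyperLTL formula at position `i`. -/
def HyperLTL.Sat {X V : Type*} [DecidableEq V] {T : Set (Trace X)} :
    HyperLTL X V → Assignment V T → ℕ → Prop
  | .ex π φ, A, i => ∃ τ : T, φ.Sat (Function.update A π (some τ)) i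
  | .all π φ, A, i => ∀ τ : T, φ.Sat (Function.update A π (some τ)) i
  | .body φ, A, i => φ.Sat A i

/-- `T` is a model of the sentence `φ`: it is satisfied at position `0` by the empty
assignment. -/
def HyperLTL.Models {X V : Type*} [DecidableEq V] (T : Set (Trace X)) (φ : HyperLTL X V) : Prop :=
  φ.Sat (fun _ => none : Assignment V T) 0

/-- The set of sets of infinite traces that a sentence defines. -/
def HyperLTL.generated {X V : Type*} [DecidableEq V] (φ : HyperLTL X V) : Set (Set (Trace X)) :=
  {T | φ.Models T}

end TwoState

/-!
Two families of two-element trace sets show that no sentence works. In `witness a x y z d e` the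
first trace has `a` at position `0`, `x` exactly at `0` and `d`, `y` always and `z` never; the
second has `a` at position `d`, `x` exactly at `d` and `e`, `y` never and `z` always.

* For `e = 2 * d` the suffixes from the first `a` agree on `x`, and no prefix before it satisfies
  `y`; so two-state independence holds, even under segment semantics
  (`range_witness_mem_asyncIndep`).
* For `e = 2 * d - 1` it fails even under point semantics and even when `a` may be placed anew
  (`hide_range_witness_notMem_hiddenIndep`). At position `0` the traces have the `(x, y)`-values
  `(1, 1)` and `(0, 0)`, so the action must come at position `0` in one of them, whatever copies of
  the traces with other actions are used. As `z` tells the two traces apart, independence of `x`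
  and `z` then forces the `x`-sequence of one trace to be a suffix of that of the other, which the
  distances `d` and `d - 1` between the two occurrences of `x` exclude.

The second set arises from the first by deleting, in both traces, one and the same position inside
the constant block strictly between `d` and `2 * d`. A quantifier-free formula whose `X`-nesting
depth is below the length of that block does not notice the deletion (`Body.sat_delete_iff`); this
follows from the expansion law of `U` alone, and it lifts to quantified formulas
(`HyperLTL.models_range_delete_iff`). Since segment independence implies point independence, and
hiding `a` turns the asynchronous property into the hidden one, this refutes all four equalities.
-/

namespace TwoState

/-! ### Insensitivity of HyperLTL to the length of constant blocks -/

/-- The nesting depth of the operator `X` in a quantifier-free formula. -/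
def Body.nextDepth {X V : Type*} : Body X V → ℕ
  | .atom _ _ => 0
  | .neg φ => φ.nextDepth
  | .or φ ψ => max φ.nextDepth ψ.nextDepth
  | .next φ => φ.nextDepth + 1
  | .until φ ψ => max φ.nextDepth ψ.nextDepth

/-- The nesting depth of the operator `X` in a HyperLTL formula. -/
def HyperLTL.nextDepth {X V : Type*} : HyperLTL X V → ℕ
  | .ex _ φ => φ.nextDepth
  | .all _ φ => φ.nextDepth
  | .body φ => φ.nextDepth

/-- The expansion law of the operator `U`. -/
lemma Body.sat_until_iff {X V : Type*} {T : Set (Trace X)} (A : Assignment V T) (φ ψ : Body X V)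
    (i : ℕ) : (Body.until φ ψ).Sat A i ↔
      ψ.Sat A i ∨ (φ.Sat A i ∧ (Body.until φ ψ).Sat A (i + 1)) := by
  simp only [Body.Sat]
  constructor
  · rintro ⟨j, hij, hj, hlt⟩
    rcases hij.eq_or_lt with rfl | h
    · exact .inl hj
    · exact .inr ⟨hlt i le_rfl h, j, h, hj, fun j' h1 h2 => hlt j' (by omega) h2⟩
  · rintro (h | ⟨h, j, hij, hj, hlt⟩)
    · exact ⟨i, le_rfl, h, fun j' h1 h2 => by omega⟩
    · refine ⟨j, by omega, hj, fun j' h1 h2 => ?_⟩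
      rcases h1.eq_or_lt with rfl | h3
      · exact h
      · exact hlt j' h3 h2

/-- If the letters at `p, …, p + k` coincide, then formulas of depth below `k` do not distinguish
the positions `p` and `p + 1`. -/
lemma Body.sat_succ_iff_of_block {X V : Type*} {T : Set (Trace X)} {A : Assignment V T}
    (φ : Body X V) {p k : ℕ}
    (hA : ∀ π b j, p ≤ j → j < p + k →
      ((Body.atom b π).Sat A j ↔ (Body.atom b π).Sat A (j + 1)))
    (hφ : φ.nextDepth < k) : φ.Sat A p ↔ φ.Sat A (p + 1) := by
  induction φ generalizing p k with
  | atom b π => exact hA π b p le_rfl (by omega)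
  | neg φ ih => exact not_congr (ih hA hφ)
  | or φ ψ ih₁ ih₂ =>
    simp only [Body.nextDepth, max_lt_iff] at hφ
    exact or_congr (ih₁ hA hφ.1) (ih₂ hA hφ.2)
  | next φ ih =>
    simp only [Body.nextDepth] at hφ
    exact ih (k := k - 1) (fun π b j h1 h2 => hA π b j (by omega) (by omega)) (by omega)
  | _ φ ψ ih₁ ih₂ =>
    simp only [Body.nextDepth, max_lt_iff] at hφ
    have h₁ := ih₁ hA hφ.1
    have h₂ := ih₂ hA hφ.2
    have e := Body.sat_until_iff A φ ψ p
    have e' := Body.sat_until_iff A φ ψ (p + 1)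
    tauto

/-- If `A'` has the letters of `A` from position `p + 1` on, moved one position to the left, then
so does the satisfaction of formulas. -/
lemma Body.sat_shift_iff {X V : Type*} {T T' : Set (Trace X)} {A : Assignment V T}
    {A' : Assignment V T'} (φ : Body X V) {p : ℕ}
    (hA : ∀ π b j, p ≤ j → ((Body.atom b π).Sat A' j ↔ (Body.atom b π).Sat A (j + 1)))
    {i : ℕ} (hi : p ≤ i) : φ.Sat A' i ↔ φ.Sat A (i + 1) := by
  induction φ generalizing i with
  | atom b π => exact hA π b i hi
  | neg φ ih => exact not_congr (ih hi)
  | or φ ψ ih₁ ih₂ => exact or_congr (ih₁ hi) (ih₂ hi)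
  | next φ ih => exact ih (i := i + 1) (by omega)
  | _ φ ψ ih₁ ih₂ =>
    simp only [Body.Sat]
    constructor
    · rintro ⟨j, hij, hj, hlt⟩
      refine ⟨j + 1, by omega, (ih₂ (by omega)).1 hj, fun j' h1 h2 => ?_⟩
      obtain ⟨m, rfl⟩ : ∃ m, j' = m + 1 := ⟨j' - 1, by omega⟩
      exact (ih₁ (by omega)).1 (hlt m (by omega) (by omega))
    · rintro ⟨j, hij, hj, hlt⟩
      obtain ⟨m, rfl⟩ : ∃ m, j = m + 1 := ⟨j - 1, by omega⟩
      exact ⟨m, by omega, (ih₂ (by omega)).2 hj, fun j' h1 h2 =>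
        (ih₁ (by omega)).2 (hlt (j' + 1) (by omega) (by omega))⟩

/-- Deleting the position `p`, the first of a block of `k + 1` equal letters, does not affect
formulas of depth below `k` at the positions up to `p`. -/
lemma Body.sat_delete_iff {X V : Type*} {T T' : Set (Trace X)} {A : Assignment V T}
    {A' : Assignment V T'} (φ : Body X V) {p k : ℕ}
    (hlt : ∀ π b j, j < p → ((Body.atom b π).Sat A' j ↔ (Body.atom b π).Sat A j))
    (hge : ∀ π b j, p ≤ j → ((Body.atom b π).Sat A' j ↔ (Body.atom b π).Sat A (j + 1)))
    (hblock : ∀ π b j, p ≤ j → j < p + k →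
      ((Body.atom b π).Sat A j ↔ (Body.atom b π).Sat A (j + 1)))
    (hφ : φ.nextDepth < k) {i : ℕ} (hi : i ≤ p) : φ.Sat A' i ↔ φ.Sat A i := by
  have hp : ∀ χ : Body X V, χ.nextDepth < k → (χ.Sat A' p ↔ χ.Sat A p) := fun χ hχ =>
    (χ.sat_shift_iff hge le_rfl).trans (χ.sat_succ_iff_of_block hblock hχ).symm
  induction φ generalizing i with
  | atom b π =>
    rcases hi.eq_or_lt with rfl | h
    · exact hp _ hφ
    · exact hlt π b i h
  | neg φ ih => exact not_congr (ih hφ hi)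
  | or φ ψ ih₁ ih₂ =>
    simp only [Body.nextDepth, max_lt_iff] at hφ
    exact or_congr (ih₁ hφ.1 hi) (ih₂ hφ.2 hi)
  | next φ ih =>
    rcases hi.eq_or_lt with rfl | h
    · exact hp _ hφ
    · simp only [Body.nextDepth] at hφ
      exact ih (by omega) (i := i + 1) h
  | _ φ ψ ih₁ ih₂ =>
    have hφ' := hφ
    simp only [Body.nextDepth, max_lt_iff] at hφ'
    -- Downward induction from `p`, by the expansion law.
    induction hi using Nat.decreasingInduction with
    | self => exact hp _ hφ
    | of_succ i h ih =>
      exact (Body.sat_until_iff A' φ ψ i).trans <|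
        (or_congr (ih₂ hφ'.2 h.le) (and_congr (ih₁ hφ'.1 h.le) ih)).trans
          (Body.sat_until_iff A φ ψ i).symm

/-- The assignment of traces `f c` that an assignment of indices `c` induces. -/
def assignmentOf {X V ι : Type*} (f : ι → Trace X) (B : V → Option ι) :
    Assignment V (Set.range f) :=
  fun v => (B v).map (Set.rangeFactorization f)

lemma update_assignmentOf {X V ι : Type*} [DecidableEq V] (f : ι → Trace X) (B : V → Option ι)
    (π : V) (c : ι) :
    Function.update (assignmentOf f B) π (some (Set.rangeFactorization f c)) =
      assignmentOf f (Function.update B π (some c)) := by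
  funext v
  by_cases h : v = π
  · subst h
    simp [assignmentOf]
  · simp [assignmentOf, h]

lemma sat_atom_assignmentOf {X V ι : Type*} (f : ι → Trace X) (B : V → Option ι) (b : X) (π : V)
    (i : ℕ) : (Body.atom b π).Sat (assignmentOf f B) i ↔ ∃ c, B π = some c ∧ f c i b = true := by
  cases h : B π <;> simp [Body.Sat, assignmentOf, h, Set.rangeFactorization]

/-- Deleting one and the same position in all traces, the first of a block of `k + 1` letters on
which every trace is constant, does not affect HyperLTL sentences of depth below `k`. -/
lemma HyperLTL.models_range_delete_iff {X V ι : Type*} [DecidableEq V] {f f' : ι → Trace X}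
    {p k : ℕ} (hlt : ∀ c j, j < p → f' c j = f c j) (hge : ∀ c j, p ≤ j → f' c j = f c (j + 1))
    (hblock : ∀ c j, p ≤ j → j < p + k → f c j = f c (j + 1)) {φ : HyperLTL X V}
    (hφ : φ.nextDepth < k) : φ.Models (Set.range f') ↔ φ.Models (Set.range f) := by
  suffices h : ∀ B : V → Option ι, φ.Sat (assignmentOf f' B) 0 ↔ φ.Sat (assignmentOf f B) 0 from
    h fun _ => none
  induction φ with
  | ex π φ ih =>
    intro B
    simp only [HyperLTL.Sat]
    rw [(Set.rangeFactorization_surjective (f := f')).exists,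
      (Set.rangeFactorization_surjective (f := f)).exists]
    simp only [update_assignmentOf, ih hφ]
  | all π φ ih =>
    intro B
    simp only [HyperLTL.Sat]
    rw [(Set.rangeFactorization_surjective (f := f')).forall,
      (Set.rangeFactorization_surjective (f := f)).forall]
    simp only [update_assignmentOf, ih hφ]
  | body φ =>
    intro B
    refine φ.sat_delete_iff (p := p) (k := k) ?_ ?_ ?_ hφ (Nat.zero_le p)
    · intro π b j hj
      simp only [sat_atom_assignmentOf, hlt _ j hj]
    · intro π b j hj
      simp only [sat_atom_assignmentOf, hge _ j hj]
    · intro π b j hj hj'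
      simp only [sat_atom_assignmentOf, hblock _ j hj hj']

/-! ### Independence on slices -/

lemma SegmentIndep.pointIndep {X : Type*} {x y : X} {S : Set (GTrace X)}
    (h : SegmentIndep x y S) : PointIndep x y S := fun i π hπ π' hπ' =>
  let ⟨ρ, hρ, H⟩ := h π hπ π' hπ'
  ⟨ρ, hρ, H i⟩

lemma asyncIndep_segmentIndep_subset {X : Type*} (a x y z : X) :
    asyncIndep SegmentIndep a x y z ⊆ asyncIndep PointIndep a x y z :=
  fun _ h => ⟨h.1.pointIndep, h.2.pointIndep⟩

lemma hiddenIndep_segmentIndep_subset {X : Type*} (a x y z : X) :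
    hiddenIndep SegmentIndep a x y z ⊆ hiddenIndep PointIndep a x y z :=
  fun _ ⟨T, hT, h⟩ => ⟨T, asyncIndep_segmentIndep_subset a x y z hT, h⟩

lemma holds_prefixOf {X : Type*} (b : X) (τ : Trace X) (k i : ℕ) :
    (prefixOf τ k).Holds b i ↔ i < k ∧ τ i b = true := by
  by_cases h : i < k <;> simp [GTrace.Holds, prefixOf, GTrace.letter, h]

lemma defined_prefixOf {X : Type*} (τ : Trace X) (k i : ℕ) :
    (prefixOf τ k).Defined i ↔ i < k := by
  by_cases h : i < k <;> simp [GTrace.Defined, prefixOf, GTrace.letter, h]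

lemma holds_suffixOf {X : Type*} (b : X) (τ : Trace X) (k i : ℕ) :
    (suffixOf τ k).Holds b i ↔ τ (k + i) b = true := by
  simp [GTrace.Holds, suffixOf, GTrace.letter]

lemma defined_suffixOf {X : Type*} (τ : Trace X) (k i : ℕ) : (suffixOf τ k).Defined i := by
  simp [GTrace.Defined, suffixOf, GTrace.letter]

lemma exists_isFirst {X : Type*} {τ : Trace X} {a : X} (h : ∃ i, τ i a = true) :
    ∃ k, IsFirst τ a k := by
  classical
  exact ⟨Nat.find h, Nat.find_spec h, fun j hj => Nat.find_min' h hj⟩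

/-- Point independence of the prefixes, spelled out for the traces themselves. -/
lemma PointIndep.exists_of_sliceBefore {X : Type*} {a x y : X} {T : Set (Trace X)}
    (h : PointIndep x y (sliceBefore a T)) {τ τ' : Trace X} (hτ : τ ∈ T) (hτ' : τ' ∈ T) {k k' : ℕ}
    (hk : IsFirst τ a k) (hk' : IsFirst τ' a k') {i : ℕ} (hi : i < k) (hi' : i < k') :
    ∃ ρ ∈ T, ρ i x = τ i x ∧ ρ i y = τ' i y := by
  obtain ⟨_, ⟨ρ, hρ, m, -, rfl⟩, H⟩ :=
    h i _ ⟨τ, hτ, k, hk, rfl⟩ _ ⟨τ', hτ', k', hk', rfl⟩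
  simp only [defined_prefixOf, holds_prefixOf] at H
  obtain ⟨hm, h1, h2⟩ := H ⟨hi, hi'⟩
  simp only [hi, hi', hm, true_and, ← Bool.eq_iff_iff] at h1 h2
  exact ⟨ρ, hρ, h1.symm, h2.symm⟩

/-- Point independence of the suffixes, spelled out for the traces themselves. -/
lemma PointIndep.exists_of_sliceFrom {X : Type*} {a x z : X} {T : Set (Trace X)}
    (h : PointIndep x z (sliceFrom a T)) {τ τ' : Trace X} (hτ : τ ∈ T) (hτ' : τ' ∈ T) {k k' : ℕ}
    (hk : IsFirst τ a k) (hk' : IsFirst τ' a k') (i : ℕ) :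
    ∃ ρ ∈ T, ∃ m, IsFirst ρ a m ∧ ρ (m + i) x = τ (k + i) x ∧ ρ (m + i) z = τ' (k' + i) z := by
  obtain ⟨_, ⟨ρ, hρ, m, hm, rfl⟩, H⟩ :=
    h i _ ⟨τ, hτ, k, hk, rfl⟩ _ ⟨τ', hτ', k', hk', rfl⟩
  simp only [holds_suffixOf] at H
  obtain ⟨-, h1, h2⟩ := H ⟨defined_suffixOf .., defined_suffixOf ..⟩
  rw [← Bool.eq_iff_iff] at h1 h2
  exact ⟨ρ, hρ, m, hm, h1.symm, h2.symm⟩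

/-! ### The witnesses -/

open Classical in
/-- The two witness traces. The trace `false` has `a` at `0`, `x` at `0` and `d`, and `y`
everywhere; the trace `true` has `a` at `d`, `x` at `d` and `e`, and `z` everywhere. -/
noncomputable def witness {X : Type*} (a x y z : X) (d e : ℕ) : Bool → Trace X
  | false, i, b => decide ((b = a ∧ i = 0) ∨ (b = x ∧ (i = 0 ∨ i = d)) ∨ b = y)
  | true, i, b => decide ((b = a ∧ i = d) ∨ (b = x ∧ (i = d ∨ i = e)) ∨ b = z)

/-- For `d = k + 2`, deleting the position `d + 1` decreases `e` from `2 * d` to `2 * d - 1` and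
changes nothing else. -/
lemma witness_delete {X : Type*} (a x y z : X) (k : ℕ) :
    (∀ c j, j < k + 3 →
      witness a x y z (k + 2) (2 * k + 3) c j = witness a x y z (k + 2) (2 * k + 4) c j) ∧
    (∀ c j, k + 3 ≤ j →
      witness a x y z (k + 2) (2 * k + 3) c j = witness a x y z (k + 2) (2 * k + 4) c (j + 1)) ∧
    (∀ c j, k + 3 ≤ j → j < k + 3 + k →
      witness a x y z (k + 2) (2 * k + 4) c j =
        witness a x y z (k + 2) (2 * k + 4) c (j + 1)) := by
  refine ⟨?_, ?_, ?_⟩ <;> rintro (_ | _) j hj <;> try intro hj'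
  all_goals
    funext b
    simp only [witness, decide_eq_decide] <;> grind

/-- The sentence `φ` does not distinguish the two witnesses, with `g` applied to each trace. -/
lemma HyperLTL.models_witness_iff {X Y V : Type*} [DecidableEq V] (φ : HyperLTL Y V)
    (g : Valuation X → Valuation Y) (a x y z : X) :
    φ.Models ((fun τ i => g (τ i)) ''
        Set.range (witness a x y z (φ.nextDepth + 3) (2 * φ.nextDepth + 5))) ↔
      φ.Models ((fun τ i => g (τ i)) ''
        Set.range (witness a x y z (φ.nextDepth + 3) (2 * φ.nextDepth + 6))) := by
  obtain ⟨h1, h2, h3⟩ := witness_delete a x y z (φ.nextDepth + 1)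
  rw [← Set.range_comp, ← Set.range_comp]
  refine HyperLTL.models_range_delete_iff (p := φ.nextDepth + 4) (k := φ.nextDepth + 1)
    (fun c j hj => congrArg g (h1 c j hj)) (fun c j hj => congrArg g (h2 c j hj))
    (fun c j hj hj' => congrArg g (h3 c j hj hj')) (by omega)

/-- With `e = 2 * d`, two-state independence holds: the suffixes agree on `x`, and `y` occurs in
no prefix. -/
lemma range_witness_mem_asyncIndep {X : Type*} {a x y z : X} (hd : [a, x, y, z].Nodup) (d : ℕ) :
    Set.range (witness a x y z d (2 * d)) ∈ asyncIndep SegmentIndep a x y z := by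
  simp only [List.nodup_cons, List.mem_cons, List.not_mem_nil, not_or, or_false] at hd
  obtain ⟨⟨hax, hay, haz⟩, ⟨hxy, hxz⟩, hyz, -⟩ := hd
  have hfirst : ∀ c k, IsFirst (witness a x y z d (2 * d) c) a k → k = if c then d else 0 := by
    rintro (_ | _) k ⟨hk, -⟩ <;> simpa [witness, hax, hay, haz] using hk
  constructor
  · have hy : ∀ σ ∈ sliceBefore a (Set.range (witness a x y z d (2 * d))), ∀ i,
        ¬ σ.Holds y i := by
      rintro _ ⟨_, ⟨c, rfl⟩, k, hk, rfl⟩ i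
      rw [holds_prefixOf]
      have := hfirst c k hk
      cases c
      · simp_all
      · simp [witness, Ne.symm hay, Ne.symm hxy, hyz]
    exact fun π hπ π' hπ' => ⟨π, hπ, fun i hi =>
      ⟨hi.1, Iff.rfl, iff_of_false (hy π' hπ' i) (hy π hπ i)⟩⟩
  · have hx : ∀ σ ∈ sliceFrom a (Set.range (witness a x y z d (2 * d))), ∀ i,
        σ.Holds x i ↔ i = 0 ∨ i = d := by
      rintro _ ⟨_, ⟨c, rfl⟩, k, hk, rfl⟩ i
      rw [holds_suffixOf, hfirst c k hk]
      cases c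
      · simp [witness, Ne.symm hax, hxy]
      · simp [witness, Ne.symm hax, hxz]
        omega
    exact fun π hπ π' hπ' => ⟨π', hπ', fun i hi =>
      ⟨hi.2, (hx π hπ i).trans (hx π' hπ' i).symm, Iff.rfl⟩⟩

lemma exists_range_witness {X : Type*} (a x y z : X) (d e : ℕ) :
    ∀ τ ∈ Set.range (witness a x y z d e), ∃ i, τ i a = true := by
  rintro _ ⟨_ | _, rfl⟩
  · exact ⟨0, by simp [witness]⟩
  · exact ⟨d, by simp [witness]⟩

/-- With `e = 2 * d - 1`, no choice of actions yields two-state independence. -/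
lemma hide_range_witness_notMem_hiddenIndep {X : Type*} {a x y z : X} (hd : [a, x, y, z].Nodup)
    {d e : ℕ} (hd2 : 2 ≤ d) (he : e + 1 = 2 * d) :
    hideTrace a '' Set.range (witness a x y z d e) ∉ hiddenIndep PointIndep a x y z := by
  rintro ⟨T, ⟨hpre, hsuf⟩, ha, hT⟩
  simp only [List.nodup_cons, List.mem_cons, List.not_mem_nil, not_or, or_false] at hd
  obtain ⟨⟨hax, hay, haz⟩, ⟨hxy, hxz⟩, hyz, -⟩ := hd
  -- Every trace of `T` agrees off `a` with one of the two witness traces, and both occur.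
  have hex : ∀ c, ∃ τ ∈ T, ∀ i, ∀ b, b ≠ a → τ i b = witness a x y z d e c i b := by
    intro c
    have : hideTrace a (witness a x y z d e c) ∈ hideTrace a '' T := hT ▸ ⟨_, ⟨c, rfl⟩, rfl⟩
    obtain ⟨τ, hτ, h⟩ := this
    exact ⟨τ, hτ, fun i b hb => congrFun (congrFun h i) ⟨b, hb⟩⟩
  have hall : ∀ τ ∈ T, ∃ c, ∀ i, ∀ b, b ≠ a → τ i b = witness a x y z d e c i b := by
    intro τ hτ
    have : hideTrace a τ ∈ hideTrace a '' Set.range (witness a x y z d e) := hT ▸ ⟨τ, hτ, rfl⟩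
    obtain ⟨_, ⟨c, rfl⟩, h⟩ := this
    exact ⟨c, fun i b hb => (congrFun (congrFun h i) ⟨b, hb⟩).symm⟩
  have hx0 : ∀ i, witness a x y z d e false i x = true ↔ i = 0 ∨ i = d := fun i => by
    simp [witness, Ne.symm hax, hxy]
  have hx1 : ∀ i, witness a x y z d e true i x = true ↔ i = d ∨ i = e := fun i => by
    simp [witness, Ne.symm hax, hxz]
  have hy : ∀ c i, witness a x y z d e c i y = !c := by
    rintro (_ | _) i <;> simp [witness, Ne.symm hay, Ne.symm hxy, hyz]
  have hz : ∀ c i, witness a x y z d e c i z = c := by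
    rintro (_ | _) i <;> simp [witness, Ne.symm haz, Ne.symm hxz, Ne.symm hyz]
  obtain ⟨τ₀, hτ₀, h₀⟩ := hex false
  obtain ⟨τ₁, hτ₁, h₁⟩ := hex true
  obtain ⟨k₀, hk₀⟩ := exists_isFirst (ha τ₀ hτ₀)
  obtain ⟨k₁, hk₁⟩ := exists_isFirst (ha τ₁ hτ₁)
  -- `T` may hold several copies of a witness trace, with different actions; so the position of
  -- the action is determined for all copies of one of the two at once.
  have hzero : (∀ τ ∈ T, ∀ k, IsFirst τ a k → τ 0 z = false → k = 0) ∨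
      (∀ τ ∈ T, ∀ k, IsFirst τ a k → τ 0 z = true → k = 0) := by
    by_contra! ⟨⟨τ, hτ, k, hk, hτz, hk0⟩, τ', hτ', k', hk', hτz', hk0'⟩
    obtain ⟨ρ, hρ, hρx, hρy⟩ := hpre.exists_of_sliceBefore hτ hτ' hk hk'
      (Nat.pos_of_ne_zero hk0) (Nat.pos_of_ne_zero hk0')
    obtain ⟨c, hc⟩ := hall τ hτ
    obtain ⟨c', hc'⟩ := hall τ' hτ'
    obtain ⟨r, hr⟩ := hall ρ hρ
    rw [hc _ _ (Ne.symm haz), hz] at hτz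
    rw [hc' _ _ (Ne.symm haz), hz] at hτz'
    subst hτz hτz'
    rw [hr _ _ (Ne.symm hay), hc' _ _ (Ne.symm hay), hy, hy] at hρy
    obtain rfl : r = true := by simpa using hρy
    rw [hr _ _ (Ne.symm hax), hc _ _ (Ne.symm hax), Bool.eq_iff_iff, hx0, hx1] at hρx
    omega
  rcases hzero with hzero | hzero
  · have key : ∀ i, (i = 0 ∨ i = d) ↔ (k₁ + i = d ∨ k₁ + i = e) := by
      intro i
      obtain ⟨ρ, hρ, m, hm, hρx, hρz⟩ := hsuf.exists_of_sliceFrom hτ₁ hτ₀ hk₁ hk₀ i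
      obtain ⟨r, hr⟩ := hall ρ hρ
      rw [hr _ _ (Ne.symm haz), h₀ _ _ (Ne.symm haz), hz, hz] at hρz
      subst hρz
      obtain rfl := hzero ρ hρ m hm (by rw [hr _ _ (Ne.symm haz), hz])
      rw [hr _ _ (Ne.symm hax), h₁ _ _ (Ne.symm hax), Bool.eq_iff_iff, hx0, hx1] at hρx
      simpa using hρx
    have := key 0
    have := key d
    omega
  · have key : ∀ i, (i = d ∨ i = e) ↔ (k₀ + i = 0 ∨ k₀ + i = d) := by
      intro i
      obtain ⟨ρ, hρ, m, hm, hρx, hρz⟩ := hsuf.exists_of_sliceFrom hτ₀ hτ₁ hk₀ hk₁ i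
      obtain ⟨r, hr⟩ := hall ρ hρ
      rw [hr _ _ (Ne.symm haz), h₁ _ _ (Ne.symm haz), hz, hz] at hρz
      subst hρz
      obtain rfl := hzero ρ hρ m hm (by rw [hr _ _ (Ne.symm haz), hz])
      rw [hr _ _ (Ne.symm hax), h₀ _ _ (Ne.symm hax), Bool.eq_iff_iff, hx0, hx1] at hρx
      simpa using hρx
    have := key 0
    have := key d
    omega

lemma range_witness_notMem_asyncIndep {X : Type*} {a x y z : X} (hd : [a, x, y, z].Nodup)
    {d e : ℕ} (hd2 : 2 ≤ d) (he : e + 1 = 2 * d) :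
    Set.range (witness a x y z d e) ∉ asyncIndep PointIndep a x y z := fun h =>
  hide_range_witness_notMem_hiddenIndep hd hd2 he ⟨_, h, exists_range_witness a x y z d e, rfl⟩

/-- No sentence defines a property between segment and point semantics, in the asynchronous
case. -/
lemma HyperLTL.generated_ne_of_async {X V : Type*} [DecidableEq V] {a x y z : X}
    (hd : [a, x, y, z].Nodup) (φ : HyperLTL X V) {P : Set (Set (Trace X))}
    (hP : asyncIndep SegmentIndep a x y z ⊆ P) (hP' : P ⊆ asyncIndep PointIndep a x y z) :
    φ.generated ≠ P := by
  rintro rfl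
  have hgood := hP (range_witness_mem_asyncIndep hd (φ.nextDepth + 3))
  refine range_witness_notMem_asyncIndep hd (d := φ.nextDepth + 3) (e := 2 * φ.nextDepth + 5)
    (by omega) (by omega) (hP' ?_)
  have h := φ.models_witness_iff id a x y z
  simp only [id, Set.image_id'] at h
  exact h.2 hgood

/-- No sentence defines a property between segment and point semantics, in the hidden case. -/
lemma HyperLTL.generated_ne_of_hidden {X V : Type*} [DecidableEq V] {a x y z : X}
    (hd : [a, x, y, z].Nodup) (φ : HyperLTL {b : X // b ≠ a} V)
    {P : Set (Set (Trace {b : X // b ≠ a}))}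
    (hP : hiddenIndep SegmentIndep a x y z ⊆ P) (hP' : P ⊆ hiddenIndep PointIndep a x y z) :
    φ.generated ≠ P := by
  rintro rfl
  have hgood := hP ⟨_, range_witness_mem_asyncIndep hd (φ.nextDepth + 3),
    exists_range_witness a x y z _ _, rfl⟩
  refine hide_range_witness_notMem_hiddenIndep hd (d := φ.nextDepth + 3)
    (e := 2 * φ.nextDepth + 5) (by omega) (by omega) (hP' ?_)
  exact (φ.models_witness_iff (fun v b => v b.1) a x y z).2 hgood

end TwoState

theorem theorem4 {X V : Type*} [Finite X] [DecidableEq V] (a x y z : X)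
    (hdistinct : [a, x, y, z].Nodup) :
    (∀ φ : TwoState.HyperLTL X V, φ.IsSentence →
      φ.generated ≠ TwoState.asyncIndep TwoState.PointIndep a x y z ∧
      φ.generated ≠ TwoState.asyncIndep TwoState.SegmentIndep a x y z) ∧
    (∀ φ : TwoState.HyperLTL {b : X // b ≠ a} V, φ.IsSentence →
      φ.generated ≠ TwoState.hiddenIndep TwoState.PointIndep a x y z ∧
      φ.generated ≠ TwoState.hiddenIndep TwoState.SegmentIndep a x y z) := by
  have hasync := TwoState.asyncIndep_segmentIndep_subset a x y z
  have hhidden := TwoState.hiddenIndep_segmentIndep_subset a x y z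
  exact ⟨fun φ _ => ⟨φ.generated_ne_of_async hdistinct hasync subset_rfl,
      φ.generated_ne_of_async hdistinct subset_rfl hasync⟩,
    fun φ _ => ⟨φ.generated_ne_of_hidden hdistinct hhidden subset_rfl,
      φ.generated_ne_of_hidden hdistinct subset_rfl hhidden⟩⟩
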